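/- Let a Markov decision process have finite state space $\mathcal S$ and finite action space $\mathcal A$, transition probabilities $P(s'\mid s,a)$, random rewards $r(s,a)$ with $\mathrm{Var}[r(s,a)]<\infty$ for all $(s,a)$, and discount factor $\gamma\in[0,1)$, and let $\lambda\in(0,1]$. Let $(\mathcal F_t)_{t\ge 0}$ be a filtration on a probability space. At each time $t$ a transition $(s_t,a_t,r_t,s'_t)$ is observed (for instance along a trajectory, $s'_t=s_{t+1}$), where $s_t,a_t$ are $\mathcal F_t$-measurable, $r_t,s'_t$ are $\mathcal F_{t+1}$-measurable, and conditionally on $\mathcal F_t$ the reward $r_t$ has the law of $r(s_t,a_t)$ and $s'_t$ has the law $P(\cdot\mid s_t,a_t)$. Tabular convex Q-learning starts from arbitrary $\mathcal F_0$-measurable tables $Q^A_0,Q^B_0:\mathcal S\times\mathcal A\to\mathbb R$ and, at each time $t$, chooses $a^*_t\in\arg\max_a Q^A_t(s'_t,a)$ (ties broken in any $\mathcal F_{t+1}$-measurable way), forms the target $$y_t=r_t+\gamma\Big(\lambda\min\big(Q^A_t(s'_t,a^*_t),Q^B_t(s'_t,a^*_t)\big)+(1-\lambda)\max\big(Q^A_t(s'_t,a^*_t),Q^B_t(s'_t,a^*_t)\big)\Big),$$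 and updates, for all $(s,a)$, $$Q^A_{t+1}(s,a)=Q^A_t(s,a)+\alpha_t(s,a)\big(y_t-Q^A_t(s,a)\big),\qquad Q^B_{t+1}(s,a)=Q^B_t(s,a)+\alpha_t(s,a)\big(y_t-Q^B_t(s,a)\big).$$ Assume that, with probability 1, every pair $(s,a)$ equals $(s_t,a_t)$ for infinitely many $t$, and that the learning rates are $\mathcal F_t$-measurable and satisfy, with probability 1, $\alpha_t(s,a)\in[0,1]$, $\sum_t\alpha_t(s,a)=\infty$ and $\sum_t\alpha_t(s,a)^2<\infty$ for all $(s,a)$, and $\alpha_t(s,a)=0$ for all $(s,a)\ne(s_t,a_t)$. Then the Bellman optimality equation $$Q^*(s,a)=\mathbb E[r(s,a)]+\gamma\sum_{s'}P(s'\mid s,a)\max_{b}Q^*(s',b)$$ has exactly one solution $Q^*$, and with probability 1, for all $(s,a)$, $Q^A_t(s,a)\to Q^*(s,a)$ and $Q^B_t(s,a)\to Q^*(s,a)$ as $t\to\infty$. -/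

import Mathlib

open MeasureTheory ProbabilityTheory Filter Topology

namespace ConvexQ

/-- A Markov decision process with finitely many states, and with random rewards: `trans s a s'` is
the probability of moving to `s'` from `s` under `a`, and `rewardLaw s a` is the law on `ℝ` of the
reward `r(s,a)`. -/
structure FiniteMDP (S A : Type*) [Fintype S] where
  /-- transition probabilities `P(s' | s, a)` -/
  trans : S → A → S → ℝ
  trans_nonneg : ∀ s a s', 0 ≤ trans s a s'
  trans_sum : ∀ s a, ∑ s', trans s a s' = 1
  /-- law of the reward `r(s, a)` -/
  rewardLaw : S → A → Measure ℝ
  rewardLaw_prob : ∀ s a, IsProbabilityMeasure (rewardLaw s a)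

section

variable {S A : Type*} [Fintype S]

/-- Every reward has finite variance (that is, a finite second moment). -/
def FiniteMDP.FiniteRewardVariance (M : FiniteMDP S A) : Prop :=
  ∀ s a, MemLp (fun x : ℝ => x) 2 (M.rewardLaw s a)

/-- `Q` solves the Bellman optimality equation
`Q(s,a) = E[r(s,a)] + γ ∑_{s'} P(s'|s,a) max_b Q(s',b)`. -/
def FiniteMDP.IsBellmanOptimal (M : FiniteMDP S A) (γ : ℝ) (Q : S → A → ℝ) : Prop :=
  ∀ s a, Q s a = (∫ x, x ∂(M.rewardLaw s a)) + γ * ∑ s', M.trans s a s' * ⨆ b, Q s' b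

/-- The observed transitions `(st t, ac t, rw t, nx t) = (s_t, a_t, r_t, s'_t)`, on a probability
space with filtration `𝓕`, are generated by the MDP `M`: the pair `(s_t, a_t)` is known at time `t`,
and, given the information at time `t`, the reward `r_t` has law `rewardLaw s_t a_t` and the next
state `s'_t` has law `P(· | s_t, a_t)`.  How `s_t` and `a_t` are chosen is left free (arbitrary
behaviour policy; a single trajectory is the case `s_{t+1} = s'_t`), and so is the joint conditional
law of `r_t` and `s'_t`. -/
structure GeneratedBy [MeasurableSpace S] [MeasurableSpace A] {Ω : Type*} {m : MeasurableSpace Ω}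
    (M : FiniteMDP S A) (μ : Measure Ω) (𝓕 : Filtration ℕ m)
    (st : ℕ → Ω → S) (ac : ℕ → Ω → A) (rw : ℕ → Ω → ℝ) (nx : ℕ → Ω → S) : Prop where
  state_meas : ∀ t, Measurable[𝓕 t] (st t)
  action_meas : ∀ t, Measurable[𝓕 t] (ac t)
  reward_meas : ∀ t, Measurable[𝓕 (t + 1)] (rw t)
  next_meas : ∀ t, Measurable[𝓕 (t + 1)] (nx t)
  reward_law : ∀ t, ∀ B : Set ℝ, MeasurableSet B →
    μ⟦rw t ⁻¹' B | 𝓕 t⟧ =ᵐ[μ] fun ω => (M.rewardLaw (st t ω) (ac t ω)).real B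
  next_law : ∀ t, ∀ x : S,
    μ⟦nx t ⁻¹' {x} | 𝓕 t⟧ =ᵐ[μ] fun ω => M.trans (st t ω) (ac t ω) x

/-- The learning rates `α t ω s a = α_t(s,a)`: known at time `t`, and almost surely in `[0,1]`, zero
off the current pair `(s_t, a_t)`, with `∑_t α_t(s,a) = ∞` and `∑_t α_t(s,a)² < ∞` for all pairs. -/
structure RobbinsMonro {Ω : Type*} {m : MeasurableSpace Ω} (μ : Measure Ω) (𝓕 : Filtration ℕ m)
    (st : ℕ → Ω → S) (ac : ℕ → Ω → A) (α : ℕ → Ω → S → A → ℝ) : Prop where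
  meas : ∀ t s a, Measurable[𝓕 t] (fun ω => α t ω s a)
  mem_Icc : ∀ᵐ ω ∂μ, ∀ t s a, α t ω s a ∈ Set.Icc (0 : ℝ) 1
  zero_off : ∀ᵐ ω ∂μ, ∀ t s a, (s, a) ≠ (st t ω, ac t ω) → α t ω s a = 0
  sum_eq_top : ∀ᵐ ω ∂μ, ∀ s a,
    Tendsto (fun n => ∑ t ∈ Finset.range n, α t ω s a) atTop atTop
  sum_sq : ∀ᵐ ω ∂μ, ∀ s a, Summable (fun t => (α t ω s a) ^ 2)

end

/-- The target `r + γ (λ min(Q^A(s',a*), Q^B(s',a*)) + (1 - λ) max(Q^A(s',a*), Q^B(s',a*)))`. -/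
noncomputable def target {S A : Type*} (γ lam : ℝ) (QA QB : S → A → ℝ) (r : ℝ) (s' : S) (b : A) :
    ℝ :=
  r + γ * (lam * min (QA s' b) (QB s' b) + (1 - lam) * max (QA s' b) (QB s' b))

/-- The tables `QA t ω`, `QB t ω` are produced by tabular convex Q-learning from the transitions
`(st, ac, rw, nx)` with learning rates `α`.  The initial tables are arbitrary (possibly random, but
known at time `0`), `gr t` is the greedy action `a* = argmax_a Q^A_t(s'_t, a)`, with ties broken in
any way that does not look into the future, and both tables are moved towards the same target;
since `α_t` vanishes off `(s_t, a_t)`, only the entry of the current pair changes. -/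
structure IsConvexQLearning {S A Ω : Type*} [MeasurableSpace A] {m : MeasurableSpace Ω}
    (𝓕 : Filtration ℕ m) (γ lam : ℝ) (rw : ℕ → Ω → ℝ) (nx : ℕ → Ω → S)
    (α : ℕ → Ω → S → A → ℝ) (gr : ℕ → Ω → A) (QA QB : ℕ → Ω → S → A → ℝ) : Prop where
  initA_meas : ∀ s a, Measurable[𝓕 0] (fun ω => QA 0 ω s a)
  initB_meas : ∀ s a, Measurable[𝓕 0] (fun ω => QB 0 ω s a)
  greedy_meas : ∀ t, Measurable[𝓕 (t + 1)] (gr t)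
  greedy : ∀ t ω b, QA t ω (nx t ω) b ≤ QA t ω (nx t ω) (gr t ω)
  updateA : ∀ t ω s a, QA (t + 1) ω s a = QA t ω s a +
    α t ω s a * (target γ lam (QA t ω) (QB t ω) (rw t ω) (nx t ω) (gr t ω) - QA t ω s a)
  updateB : ∀ t ω s a, QB (t + 1) ω s a = QB t ω s a +
    α t ω s a * (target γ lam (QA t ω) (QB t ω) (rw t ω) (nx t ω) (gr t ω) - QB t ω s a)

end ConvexQ

/-!
The Bellman operator is a `γ`-contraction for the sup norm, which gives existence and uniqueness of
`Q*`. For the convergence, two observations reduce the problem to a linear noise recursion and a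
deterministic iteration.

* Both tables move towards the same target, so `Q^A - Q^B` is multiplied by `1 - α` in each update
  and vanishes because the step sizes have infinite sum. As the convex combination of the minimum
  and the maximum is within `|Q^A - Q^B|` of `Q^A`, the target is that of ordinary Q-learning for
  `Q^A` up to a vanishing error (`ConvexQ.abs_target_sub_le`).
* For every realisation of the next state `s'`, the map `Q ↦ r + γ max_b Q(s', b)` is `γ`-Lipschitz.
  Comparing with its value at `Q*`, the target minus `Q*(s_t, a_t)` is the noise
  `n_t = r_t + γ max_b Q*(s'_t, b) - Q*(s_t, a_t)` plus a term of size at most `γ` times the sup norm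
  of `Q^A - Q*`, up to the vanishing error. The noise involves only the fixed table `Q*`, not the
  iterates, so its conditional variance is bounded without any stability estimate for the tables.

The series `∑ α_t(s,a) n_t` converges almost surely by the martingale convergence theorem, after
switching the step sizes off once the running sum of their squares exceeds a level `K`
(`ae_exists_tendsto_sum_mul`). Hence the averaged noise vanishes
(`tendsto_zero_of_averaging_of_series`), and the remaining part of the error follows an asynchronous
averaging iteration with contracting targets, which converges to zero by successively shrinking an
eventual bound on its norm (`tendsto_zero_of_contracting_averaging`).
-/

/-! ### Averaging recursions with divergent step sizes -/

/-- A sequence pulled below `B` with non-summable step sizes is eventually below `B + ε`. -/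
theorem eventually_le_of_averaging {x a : ℕ → ℝ} {B : ℝ} (ha : ∀ t, a t ∈ Set.Icc (0 : ℝ) 1)
    (hsum : Tendsto (fun n => ∑ t ∈ Finset.range n, a t) atTop atTop)
    (hx : ∀ᶠ t in atTop, x (t + 1) ≤ (1 - a t) * x t + a t * B) {ε : ℝ} (hε : 0 < ε) :
    ∀ᶠ t in atTop, x t ≤ B + ε := by
  obtain ⟨T, hT⟩ := eventually_atTop.1 hx
  set s : ℕ → ℝ := fun n => ∑ t ∈ Finset.range n, a t with hs
  have key : ∀ t, T ≤ t → x t - B ≤ |x T - B| * Real.exp (s T - s t) := by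
    intro t ht
    induction t, ht using Nat.le_induction with
    | base => simpa using le_abs_self (x T - B)
    | succ t ht ih =>
      have h1 : s (t + 1) = s t + a t := Finset.sum_range_succ _ _
      have h2 : 1 - a t ≤ Real.exp (-a t) := Real.one_sub_le_exp_neg _
      have h3 : s T - s (t + 1) = (s T - s t) + -a t := by rw [h1]; ring
      have h0 : 0 ≤ 1 - a t := sub_nonneg.2 (ha t).2
      calc x (t + 1) - B ≤ (1 - a t) * (x t - B) := by linarith [hT t ht]
        _ ≤ (1 - a t) * (|x T - B| * Real.exp (s T - s t)) := by gcongr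
        _ ≤ Real.exp (-a t) * (|x T - B| * Real.exp (s T - s t)) := by gcongr
        _ = _ := by rw [h3, Real.exp_add]; ring
  have hlim : Tendsto (fun t => |x T - B| * Real.exp (s T - s t)) atTop (𝓝 0) := by
    have h1 : Tendsto (fun t => s T - s t) atTop atBot :=
      tendsto_atBot_add_const_left _ _ (tendsto_neg_atTop_atBot.comp hsum)
    simpa using (Real.tendsto_exp_atBot.comp h1).const_mul (|x T - B|)
  filter_upwards [hlim.eventually_lt_const hε, eventually_ge_atTop T] with t h1 h2
  linarith [key t h2]

/-- Averaging with divergent step sizes inherits an eventual bound on the absolute values of the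
averaged quantities. -/
theorem eventually_abs_le_of_averaging {x a c : ℕ → ℝ} {B : ℝ}
    (ha : ∀ t, a t ∈ Set.Icc (0 : ℝ) 1)
    (hsum : Tendsto (fun n => ∑ t ∈ Finset.range n, a t) atTop atTop)
    (hx : ∀ t, x (t + 1) = (1 - a t) * x t + a t * c t)
    (hc : ∀ᶠ t in atTop, |c t| ≤ B) {ε : ℝ} (hε : 0 < ε) :
    ∀ᶠ t in atTop, |x t| ≤ B + ε := by
  refine eventually_le_of_averaging (x := fun t => |x t|) ha hsum ?_ hε
  filter_upwards [hc] with t ht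
  have h0 : 0 ≤ 1 - a t := sub_nonneg.2 (ha t).2
  have h1 := (ha t).1
  rw [hx]
  calc |(1 - a t) * x t + a t * c t| ≤ |(1 - a t) * x t| + |a t * c t| := abs_add_le _ _
    _ = (1 - a t) * |x t| + a t * |c t| := by
      rw [abs_mul, abs_mul, abs_of_nonneg h0, abs_of_nonneg h1]
    _ ≤ _ := by gcongr

theorem tendsto_zero_of_averaging {x a c : ℕ → ℝ}
    (ha : ∀ t, a t ∈ Set.Icc (0 : ℝ) 1)
    (hsum : Tendsto (fun n => ∑ t ∈ Finset.range n, a t) atTop atTop)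
    (hx : ∀ t, x (t + 1) = (1 - a t) * x t + a t * c t)
    (hc : Tendsto c atTop (𝓝 0)) : Tendsto x atTop (𝓝 0) := by
  rw [Metric.tendsto_nhds]
  intro ε hε
  have h1 : ∀ᶠ t in atTop, |c t| ≤ ε / 3 := by
    filter_upwards [(Metric.tendsto_nhds.1 hc) (ε / 3) (by positivity)] with t ht
    simpa using ht.le
  filter_upwards [eventually_abs_le_of_averaging ha hsum hx h1 (ε := ε / 3) (by positivity)]
    with t ht
  rw [Real.dist_eq, sub_zero]
  linarith

/-- If the noise series `∑ a t * n t` converges, then the averaged noise vanishes: subtracting the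
tail of the series turns the noise into a null sequence. -/
theorem tendsto_zero_of_averaging_of_series {x a n : ℕ → ℝ} {l : ℝ}
    (ha : ∀ t, a t ∈ Set.Icc (0 : ℝ) 1)
    (hsum : Tendsto (fun n => ∑ t ∈ Finset.range n, a t) atTop atTop)
    (hx : ∀ t, x (t + 1) = (1 - a t) * x t + a t * n t)
    (hl : Tendsto (fun N => ∑ t ∈ Finset.range N, a t * n t) atTop (𝓝 l)) :
    Tendsto x atTop (𝓝 0) := by
  set s : ℕ → ℝ := fun N => ∑ t ∈ Finset.range N, a t * n t with hs
  have hc : Tendsto (fun t => l - s t) atTop (𝓝 0) := by simpa using hl.const_sub l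
  have hu : Tendsto (fun t => x t + (l - s t)) atTop (𝓝 0) := by
    refine tendsto_zero_of_averaging ha hsum (fun t => ?_) hc
    have h1 : s (t + 1) = s t + a t * n t := Finset.sum_range_succ _ _
    rw [hx, h1]
    ring
  simpa using hu.sub hc

/-- An asynchronous averaging iteration whose targets are bounded by `γ * (‖x t‖ + ε t)`, where
`γ < 1` and `ε` vanishes, converges to zero. -/
theorem tendsto_zero_of_contracting_averaging {ι : Type*} [Fintype ι] {x a c : ℕ → ι → ℝ}
    {ε : ℕ → ℝ} {γ : ℝ} (hγ0 : 0 ≤ γ) (hγ1 : γ < 1)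
    (ha : ∀ t i, a t i ∈ Set.Icc (0 : ℝ) 1)
    (hsum : ∀ i, Tendsto (fun n => ∑ t ∈ Finset.range n, a t i) atTop atTop)
    (hx : ∀ t i, x (t + 1) i = (1 - a t i) * x t i + a t i * c t i)
    (hc : ∀ t i, |c t i| ≤ γ * (‖x t‖ + ε t)) (hε : Tendsto ε atTop (𝓝 0)) :
    Tendsto x atTop (𝓝 0) := by
  obtain ⟨E, hE⟩ := hε.bddAbove_range
  have hE' : ∀ t, ε t ≤ E := fun t => hE ⟨t, rfl⟩
  -- `B` solves `γ * (B + E) ≤ B`, so the ball of radius `B` is invariant.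
  set B : ℝ := max (‖x 0‖ + 1) (γ * E / (1 - γ)) with hB
  have hB0 : 0 < B := lt_max_of_lt_left (by positivity)
  have hBE : γ * (B + E) ≤ B := by
    have : γ * E / (1 - γ) ≤ B := le_max_right _ _
    rw [div_le_iff₀ (by linarith)] at this
    linarith
  have hbdd : ∀ t, ‖x t‖ ≤ B := by
    intro t
    induction t with
    | zero => exact le_max_of_le_left (by linarith)
    | succ t ih =>
      rw [pi_norm_le_iff_of_nonneg hB0.le]
      intro i
      have h0 : 0 ≤ 1 - a t i := sub_nonneg.2 (ha t i).2
      have h1 := (ha t i).1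
      have h2 : |c t i| ≤ B := by
        refine (hc t i).trans (le_trans ?_ hBE)
        gcongr
        exact hE' t
      have h3 : |x t i| ≤ B := (norm_le_pi_norm (x t) i).trans ih
      rw [hx, Real.norm_eq_abs]
      calc |(1 - a t i) * x t i + a t i * c t i|
          ≤ |(1 - a t i) * x t i| + |a t i * c t i| := abs_add_le _ _
        _ = (1 - a t i) * |x t i| + a t i * |c t i| := by
          rw [abs_mul, abs_mul, abs_of_nonneg h0, abs_of_nonneg h1]
        _ ≤ (1 - a t i) * B + a t i * B := by gcongr
        _ = B := by ring
  have hstep : ∀ k : ℕ, ∀ᶠ t in atTop, ‖x t‖ ≤ ((1 + γ) / 2) ^ k * B := by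
    intro k
    induction k with
    | zero => exact Eventually.of_forall fun t => by simpa using hbdd t
    | succ k ih =>
      set b := ((1 + γ) / 2) ^ k * B with hb
      have hb0 : 0 < b := by positivity
      -- `δ` is chosen such that `γ * (b + δ) + δ = (1 + γ) / 2 * b`.
      set δ := (1 - γ) * b / (2 * (1 + γ)) with hδ
      have hδ0 : 0 < δ := by
        have : 0 < 1 - γ := by linarith
        positivity
      have hδb : γ * (b + δ) + δ = ((1 + γ) / 2) ^ (k + 1) * B := by
        rw [pow_succ, mul_right_comm, ← hb, hδ]
        field_simp
        ring
      have h1 : ∀ i, ∀ᶠ t in atTop, |x t i| ≤ γ * (b + δ) + δ := by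
        intro i
        refine eventually_abs_le_of_averaging (fun t => ha t i) (hsum i) (fun t => hx t i) ?_ hδ0
        filter_upwards [ih, hε.eventually_le_const hδ0] with t h1 h2
        refine (hc t i).trans ?_
        gcongr
      filter_upwards [eventually_all.2 h1] with t ht
      rw [← hδb, pi_norm_le_iff_of_nonneg (by positivity)]
      exact ht
  rw [Metric.tendsto_nhds]
  intro η hη
  have hpow : Tendsto (fun k : ℕ => ((1 + γ) / 2) ^ k * B) atTop (𝓝 0) := by
    simpa using (tendsto_pow_atTop_nhds_zero_of_lt_one (r := (1 + γ) / 2) (by positivity)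
      (by linarith)).mul_const B
  obtain ⟨k, hk⟩ := (hpow.eventually_lt_const hη).exists
  filter_upwards [hstep k] with t ht
  rw [dist_zero_right]
  exact ht.trans_lt hk

/-! ### Almost sure convergence of weighted noise series -/

section Noise

variable {Ω : Type*} {m : MeasurableSpace Ω} {μ : Measure Ω} [IsProbabilityMeasure μ]
  {𝓕 : Filtration ℕ m} {b n : ℕ → Ω → ℝ}

/-- If the squared weights have uniformly bounded sums and the noise has conditional mean zero and
bounded conditional variance, then the weighted partial sums form an `L²`-bounded martingale, and
hence converge almost surely. -/
theorem ae_exists_tendsto_sum_mul_of_bounded (hb : ∀ t, Measurable[𝓕 t] (b t))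
    (hn : ∀ t, Measurable[𝓕 (t + 1)] (n t)) (hn2 : ∀ t, MemLp (n t) 2 μ)
    (hmean : ∀ t, μ[n t | 𝓕 t] =ᵐ[μ] 0) {C : ℝ} (hC : 0 ≤ C)
    (hvar : ∀ t, ∀ᵐ ω ∂μ, (μ[fun ω => n t ω ^ 2 | 𝓕 t]) ω ≤ C) {K : ℝ}
    (hbK : ∀ N ω, ∑ t ∈ Finset.range N, b t ω ^ 2 ≤ K) :
    ∀ᵐ ω ∂μ, ∃ l, Tendsto (fun N => ∑ t ∈ Finset.range N, b t ω * n t ω) atTop (𝓝 l) := by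
  have hb2 : ∀ t ω, b t ω ^ 2 ≤ K := fun t ω =>
    (Finset.single_le_sum (f := fun i => b i ω ^ 2) (fun i _ => sq_nonneg _)
      (Finset.self_mem_range_succ t)).trans (hbK (t + 1) ω)
  have hbbd : ∀ t ω, ‖b t ω‖ ≤ √K := fun t ω => Real.abs_le_sqrt (hb2 t ω)
  have hbm : ∀ t, Measurable (b t) := fun t => (hb t).mono (𝓕.le t) le_rfl
  have hbi : ∀ t, Integrable (fun ω => b t ω ^ 2) μ := fun t =>
    Integrable.of_bound ((hbm t).pow_const 2).aestronglyMeasurable K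
      (ae_of_all _ fun ω => by simpa using hb2 t ω)
  set d : ℕ → Ω → ℝ := fun t => b t * n t with hd
  have hd2 : ∀ t, MemLp (d t) 2 μ := fun t =>
    (hn2 t).mul (p := ⊤) (MemLp.of_bound (hbm t).aestronglyMeasurable _
      (ae_of_all _ (hbbd t)))
  have hdm : ∀ t, μ[d t | 𝓕 t] =ᵐ[μ] 0 := fun t => by
    filter_upwards [condExp_mul_of_stronglyMeasurable_left (hb t).stronglyMeasurable
      ((hd2 t).integrable (by norm_num)) ((hn2 t).integrable (by norm_num)), hmean t] with ω h1 h2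
    rw [h1, Pi.mul_apply, h2]
    simp
  have hdvar : ∀ t, ∫ ω, d t ω ^ 2 ∂μ ≤ C * ∫ ω, b t ω ^ 2 ∂μ := fun t => by
    have heq : (fun ω => d t ω ^ 2) = (fun ω => b t ω ^ 2) * fun ω => n t ω ^ 2 := by
      ext ω
      simp [hd, mul_pow]
    rw [← integral_condExp (𝓕.le t), ← integral_const_mul]
    refine integral_mono_ae integrable_condExp ((hbi t).const_mul C) ?_
    have hpull := condExp_mul_of_stronglyMeasurable_left (μ := μ) (m := 𝓕 t)
      ((hb t).pow_const 2).stronglyMeasurable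
      (heq ▸ (hd2 t).integrable_sq) (hn2 t).integrable_sq
    filter_upwards [hpull, hvar t] with ω h1 h2
    rw [heq, h1, Pi.mul_apply, mul_comm C]
    exact mul_le_mul_of_nonneg_left h2 (sq_nonneg _)
  set M : ℕ → Ω → ℝ := fun N ω => ∑ t ∈ Finset.range N, b t ω * n t ω with hM
  have hMsucc : ∀ N, M (N + 1) = M N + d N := fun N => by
    ext ω
    exact Finset.sum_range_succ _ _
  have hMmeas : ∀ N, Measurable[𝓕 N] (M N) := fun N => by
    refine Finset.measurable_fun_sum _ fun t ht => ?_
    have ht' : t + 1 ≤ N := Finset.mem_range.1 ht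
    exact ((hb t).mono (𝓕.mono (by lia)) le_rfl).mul ((hn t).mono (𝓕.mono ht') le_rfl)
  have hM2 : ∀ N, MemLp (M N) 2 μ := fun N => memLp_finsetSum _ fun t _ => hd2 t
  have hMmart : Martingale M 𝓕 μ := by
    refine martingale_of_condExp_sub_eq_zero_nat (fun N => (hMmeas N).stronglyMeasurable)
      (fun N => (hM2 N).integrable (by norm_num)) fun N => ?_
    rw [hMsucc, add_sub_cancel_left]
    exact hdm N
  have hMsq : ∀ N, ∫ ω, M N ω ^ 2 ∂μ ≤ C * ∫ ω, ∑ t ∈ Finset.range N, b t ω ^ 2 ∂μ := by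
    intro N
    induction N with
    | zero => simp [hM]
    | succ N ih =>
      -- Martingale increments are orthogonal to the past.
      have hcross : ∫ ω, (M N * d N) ω ∂μ = 0 := by
        rw [← integral_condExp (𝓕.le N), integral_eq_zero_of_ae]
        filter_upwards [condExp_mul_of_stronglyMeasurable_left (hMmeas N).stronglyMeasurable
          ((hM2 N).integrable_mul (hd2 N)) ((hd2 N).integrable (by norm_num)), hdm N] with ω h1 h2
        rw [h1, Pi.mul_apply, h2]
        simp
      have hexp : ∀ ω, M (N + 1) ω ^ 2 = M N ω ^ 2 + 2 * (M N * d N) ω + d N ω ^ 2 := fun ω => by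
        rw [hMsucc]
        simp only [Pi.add_apply, Pi.mul_apply]
        ring
      have hi := ((hM2 N).integrable_mul (hd2 N)).const_mul 2
      have hi' : Integrable (fun ω => M N ω ^ 2 + 2 * (M N * d N) ω) μ :=
        (hM2 N).integrable_sq.add hi
      simp_rw [hexp, Finset.sum_range_succ]
      rw [integral_add hi' (hd2 N).integrable_sq,
        integral_add (hM2 N).integrable_sq hi, integral_const_mul, hcross,
        integral_add (integrable_finsetSum _ fun t _ => hbi t) (hbi N)]
      linarith [hdvar N]
  have hMK : ∀ N, ∫ ω, M N ω ^ 2 ∂μ ≤ C * K := fun N => by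
    refine (hMsq N).trans (mul_le_mul_of_nonneg_left ?_ hC)
    refine (integral_mono_of_nonneg (ae_of_all _ fun ω => Finset.sum_nonneg fun t _ => sq_nonneg _)
      (integrable_const K) (ae_of_all _ (hbK N))).trans_eq ?_
    simp
  have hL1 : ∀ N, eLpNorm (M N) 1 μ ≤ (1 + C * K).toNNReal := fun N => by
    have hi := (hM2 N).integrable (by norm_num)
    rw [eLpNorm_one_eq_lintegral_enorm, ← ofReal_integral_norm_eq_lintegral_enorm hi]
    refine ENNReal.ofReal_le_ofReal ?_
    calc ∫ ω, ‖M N ω‖ ∂μ ≤ ∫ ω, (1 + M N ω ^ 2) ∂μ := by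
          refine integral_mono hi.norm ((integrable_const _).add (hM2 N).integrable_sq) fun ω => ?_
          simp only [Real.norm_eq_abs]
          nlinarith [sq_abs (M N ω), sq_nonneg (|M N ω| - 1)]
      _ = 1 + ∫ ω, M N ω ^ 2 ∂μ := by
          rw [integral_add (integrable_const _) (hM2 N).integrable_sq]
          simp
      _ ≤ 1 + C * K := by linarith [hMK N]
  filter_upwards [hMmart.submartingale.ae_tendsto_limitProcess hL1] with ω hω
  exact ⟨_, hω⟩

/-- Weighted noise series converge almost surely as soon as the squared weights are almost surely
summable: on the event that their sum is at most `K`, the weights agree with weights that are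
switched off when the running sum of squares exceeds `K`. -/
theorem ae_exists_tendsto_sum_mul (hb : ∀ t, Measurable[𝓕 t] (b t))
    (hn : ∀ t, Measurable[𝓕 (t + 1)] (n t)) (hn2 : ∀ t, MemLp (n t) 2 μ)
    (hmean : ∀ t, μ[n t | 𝓕 t] =ᵐ[μ] 0) {C : ℝ} (hC : 0 ≤ C)
    (hvar : ∀ t, ∀ᵐ ω ∂μ, (μ[fun ω => n t ω ^ 2 | 𝓕 t]) ω ≤ C)
    (hsq : ∀ᵐ ω ∂μ, Summable fun t => b t ω ^ 2) :
    ∀ᵐ ω ∂μ, ∃ l, Tendsto (fun N => ∑ t ∈ Finset.range N, b t ω * n t ω) atTop (𝓝 l) := by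
  classical
  let G : ℕ → ℕ → Set Ω := fun K t => {ω | ∑ i ∈ Finset.range (t + 1), b i ω ^ 2 ≤ K}
  have hG : ∀ K t, MeasurableSet[𝓕 t] (G K t) := fun K t => by
    refine @measurableSet_le _ _ _ _ _ (𝓕 t) _ _ _ _ _ ?_ measurable_const
    refine Finset.measurable_fun_sum _ fun i hi => ?_
    have hi' : i ≤ t := Nat.lt_succ_iff.1 (Finset.mem_range.1 hi)
    exact ((hb i).mono (𝓕.mono hi') le_rfl).pow_const 2
  have hle : ∀ (K t : ℕ) ω, (G K t).indicator (b t) ω ^ 2 ≤ b t ω ^ 2 := fun K t ω => by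
    by_cases h : ω ∈ G K t
    · simp [h]
    · simpa [h] using sq_nonneg (b t ω)
  have key : ∀ K : ℕ, ∀ᵐ ω ∂μ, ∃ l, Tendsto
      (fun N => ∑ t ∈ Finset.range N, (G K t).indicator (b t) ω * n t ω) atTop (𝓝 l) := by
    intro K
    refine ae_exists_tendsto_sum_mul_of_bounded (b := fun t => (G K t).indicator (b t))
      (fun t => (hb t).indicator (hG K t)) hn hn2 hmean hC hvar (K := K) ?_
    intro N ω
    induction N with
    | zero => simp
    | succ N ih =>
      by_cases h : ω ∈ G K N
      · exact (Finset.sum_le_sum fun t _ => hle K t ω).trans h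
      · rw [Finset.sum_range_succ, Set.indicator_of_notMem h]
        simpa using ih
  filter_upwards [ae_all_iff.2 key, hsq] with ω h1 h2
  obtain ⟨K, hK⟩ := exists_nat_ge (∑' t, b t ω ^ 2)
  obtain ⟨l, hl⟩ := h1 K
  refine ⟨l, hl.congr fun N => Finset.sum_congr rfl fun t _ => ?_⟩
  have : ω ∈ G K t := (h2.sum_le_tsum _ fun i _ => sq_nonneg _).trans hK
  rw [Set.indicator_of_mem this]

end Noise

/-! ### Conditional expectations from conditional laws -/

section CondLaw

variable {Ω X I : Type*} {m₀ m : MeasurableSpace Ω} {μ : Measure Ω} [IsProbabilityMeasure μ]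
  [MeasurableSpace X] {Y : Ω → X} {Z : Ω → I} {ν : I → Measure X} [∀ i, IsProbabilityMeasure (ν i)]

/-- If `Y` has conditional law `ν (Z ω)` given `m₀`, then on any `m₀`-event where `Z = i` the
variable `Y` is distributed according to `ν i`, up to the mass of the event. -/
theorem map_restrict_of_condLaw (hm : m₀ ≤ m) (hY : Measurable Y)
    (hlaw : ∀ B, MeasurableSet B → μ⟦Y ⁻¹' B | m₀⟧ =ᵐ[μ] fun ω => (ν (Z ω)).real B)
    {H : Set Ω} (hH : MeasurableSet[m₀] H) {i : I} (hi : ∀ ω ∈ H, Z ω = i) :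
    (μ.restrict H).map Y = μ H • ν i := by
  ext B hB
  have hH' := hm _ hH
  rw [Measure.map_apply hY hB, Measure.restrict_apply (hY hB), Measure.smul_apply, smul_eq_mul,
    ← ENNReal.toReal_eq_toReal_iff' (by finiteness) (by finiteness), ENNReal.toReal_mul]
  change μ.real _ = μ.real H * (ν i).real B
  calc μ.real (Y ⁻¹' B ∩ H) = ∫ ω in H, (Y ⁻¹' B).indicator (fun _ => (1 : ℝ)) ω ∂μ := by
        rw [integral_indicator_const _ (hY hB), measureReal_restrict_apply (hY hB)]
        simp
    _ = ∫ ω in H, (μ⟦Y ⁻¹' B | m₀⟧) ω ∂μ :=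
        (setIntegral_condExp hm ((integrable_const 1).indicator (hY hB)) hH).symm
    _ = ∫ _ in H, (ν i).real B ∂μ := by
        refine setIntegral_congr_ae hH' ?_
        filter_upwards [hlaw B hB] with ω h1 h2
        rw [h1, hi ω h2]
    _ = μ.real H * (ν i).real B := by simp

variable [Finite I] [MeasurableSpace I] [MeasurableSingletonClass I]

theorem integrable_comp_of_condLaw (hm : m₀ ≤ m) (hY : Measurable Y) (hZ : Measurable[m₀] Z)
    (hlaw : ∀ B, MeasurableSet B → μ⟦Y ⁻¹' B | m₀⟧ =ᵐ[μ] fun ω => (ν (Z ω)).real B)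
    {f : X → ℝ} (hf : Measurable f) (hfi : ∀ i, Integrable f (ν i)) :
    Integrable (fun ω => f (Y ω)) μ := by
  have hU : (Set.univ : Set Ω) = ⋃ i, Z ⁻¹' {i} := by
    ext ω
    simp
  rw [← integrableOn_univ, hU, integrableOn_finite_iUnion]
  intro i
  have h1 := map_restrict_of_condLaw hm hY hlaw (hZ (measurableSet_singleton i)) (i := i)
    fun ω h => h
  refine (integrable_map_measure hf.aestronglyMeasurable hY.aemeasurable).1 ?_
  rw [h1]
  exact (hfi i).smul_measure (by finiteness)

theorem condExp_comp_of_condLaw (hm : m₀ ≤ m) (hY : Measurable Y) (hZ : Measurable[m₀] Z)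
    (hlaw : ∀ B, MeasurableSet B → μ⟦Y ⁻¹' B | m₀⟧ =ᵐ[μ] fun ω => (ν (Z ω)).real B)
    {f : X → ℝ} (hf : Measurable f) (hfi : ∀ i, Integrable f (ν i)) :
    μ[fun ω => f (Y ω) | m₀] =ᵐ[μ] fun ω => ∫ x, f x ∂ν (Z ω) := by
  have := Fintype.ofFinite I
  have hint := integrable_comp_of_condLaw hm hY hZ hlaw hf hfi
  have hgm : Measurable[m₀] fun ω => ∫ x, f x ∂ν (Z ω) :=
    (measurable_of_finite fun i => ∫ x, f x ∂ν i).comp hZ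
  have hgi : Integrable (fun ω => ∫ x, f x ∂ν (Z ω)) μ := by
    obtain ⟨c, hc⟩ := (Set.finite_range fun i => ‖∫ x, f x ∂ν i‖).bddAbove
    exact Integrable.of_bound (hgm.mono hm le_rfl).aestronglyMeasurable c
      (ae_of_all _ fun ω => hc ⟨Z ω, rfl⟩)
  refine (ae_eq_condExp_of_forall_setIntegral_eq hm hint (fun s _ _ => hgi.integrableOn) ?_
    hgm.stronglyMeasurable.aestronglyMeasurable).symm
  intro s hs _
  have hZi : ∀ i, MeasurableSet[m₀] (s ∩ Z ⁻¹' {i}) := fun i =>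
    hs.inter (hZ (measurableSet_singleton i))
  have hU : s = ⋃ i, s ∩ Z ⁻¹' {i} := by
    ext ω
    simp
  have hdisj : Pairwise fun i j => Disjoint (s ∩ Z ⁻¹' {i}) (s ∩ Z ⁻¹' {j}) := fun i j hij =>
    ((Set.disjoint_singleton.2 hij).preimage Z).mono Set.inter_subset_right Set.inter_subset_right
  rw [hU, integral_iUnion_fintype (fun i => hm _ (hZi i)) hdisj fun i => hgi.integrableOn,
    integral_iUnion_fintype (fun i => hm _ (hZi i)) hdisj fun i => hint.integrableOn]
  refine Finset.sum_congr rfl fun i _ => ?_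
  have h1 := map_restrict_of_condLaw hm hY hlaw (hZi i) (i := i) fun ω h => h.2
  calc ∫ ω in s ∩ Z ⁻¹' {i}, (∫ x, f x ∂ν (Z ω)) ∂μ
      = ∫ _ in s ∩ Z ⁻¹' {i}, (∫ x, f x ∂ν i) ∂μ :=
        setIntegral_congr_fun (hm _ (hZi i)) fun ω h => by rw [show Z ω = i from h.2]
    _ = ∫ x, f x ∂((μ.restrict (s ∩ Z ⁻¹' {i})).map Y) := by
        rw [h1, integral_smul_measure]
        simp [Measure.real]
    _ = _ := integral_map hY.aemeasurable hf.aestronglyMeasurable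

end CondLaw

/-! ### The Bellman operator -/

section Bellman

theorem abs_ciSup_sub_ciSup_le {A : Type*} [Finite A] [Nonempty A] {f g : A → ℝ} {c : ℝ}
    (h : ∀ b, |f b - g b| ≤ c) : |(⨆ b, f b) - ⨆ b, g b| ≤ c := by
  have key : ∀ {u w : A → ℝ}, (∀ b, u b ≤ w b + c) → (⨆ b, u b) ≤ (⨆ b, w b) + c :=
    fun {u w} h' => ciSup_le fun b =>
      (h' b).trans (by gcongr; exact le_ciSup (Set.finite_range w).bddAbove b)
  rw [abs_sub_le_iff]
  constructor
  · have := key (u := f) (w := g) fun b => by linarith [(abs_le.1 (h b)).2]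
    linarith
  · have := key (u := g) (w := f) fun b => by linarith [(abs_le.1 (h b)).1]
    linarith

variable {S A : Type*} [Fintype S] [Fintype A]

/-- The Bellman optimality operator, whose fixed points are the solutions of the Bellman optimality
equation. -/
noncomputable def ConvexQ.FiniteMDP.bellmanOperator (M : ConvexQ.FiniteMDP S A) (γ : ℝ)
    (Q : S → A → ℝ) : S → A → ℝ :=
  fun s a => (∫ x, x ∂(M.rewardLaw s a)) + γ * ∑ s', M.trans s a s' * ⨆ b, Q s' b

theorem ConvexQ.FiniteMDP.contractingWith_bellmanOperator [Nonempty A]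
    (M : ConvexQ.FiniteMDP S A) {γ : ℝ} (hγ0 : 0 ≤ γ) (hγ1 : γ < 1) :
    ContractingWith ⟨γ, hγ0⟩ (M.bellmanOperator γ) := by
  refine ⟨hγ1, LipschitzWith.of_dist_le_mul fun Q R => ?_⟩
  have hd : 0 ≤ γ * dist Q R := by positivity
  change dist _ _ ≤ γ * dist Q R
  refine (dist_pi_le_iff hd).2 fun s => (dist_pi_le_iff hd).2 fun a => ?_
  have hsup : ∀ s', |(⨆ b, Q s' b) - ⨆ b, R s' b| ≤ dist Q R := fun s' =>
    abs_ciSup_sub_ciSup_le fun b =>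
      ((dist_le_pi_dist (Q s') (R s') b).trans (dist_le_pi_dist Q R s'))
  have heq : M.bellmanOperator γ Q s a - M.bellmanOperator γ R s a =
      γ * ∑ s', M.trans s a s' * ((⨆ b, Q s' b) - ⨆ b, R s' b) := by
    simp only [bellmanOperator, mul_sub, Finset.sum_sub_distrib]
    ring
  rw [Real.dist_eq, heq, abs_mul, abs_of_nonneg hγ0]
  gcongr
  calc |∑ s', M.trans s a s' * ((⨆ b, Q s' b) - ⨆ b, R s' b)|
      ≤ ∑ s', |M.trans s a s' * ((⨆ b, Q s' b) - ⨆ b, R s' b)| := Finset.abs_sum_le_sum_abs _ _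
    _ ≤ ∑ s', M.trans s a s' * dist Q R := by
        refine Finset.sum_le_sum fun s' _ => ?_
        rw [abs_mul, abs_of_nonneg (M.trans_nonneg s a s')]
        exact mul_le_mul_of_nonneg_left (hsup s') (M.trans_nonneg s a s')
    _ = dist Q R := by rw [← Finset.sum_mul, M.trans_sum, one_mul]

theorem ConvexQ.FiniteMDP.existsUnique_isBellmanOptimal [Nonempty A]
    (M : ConvexQ.FiniteMDP S A) {γ : ℝ} (hγ0 : 0 ≤ γ) (hγ1 : γ < 1) :
    ∃! Q : S → A → ℝ, M.IsBellmanOptimal γ Q := by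
  have hT := M.contractingWith_bellmanOperator hγ0 hγ1
  have hiff : ∀ Q, M.IsBellmanOptimal γ Q ↔ Function.IsFixedPt (M.bellmanOperator γ) Q := fun Q =>
    ⟨fun h => funext fun s => funext fun a => (h s a).symm,
      fun h s a => (congrFun (congrFun h s) a).symm⟩
  refine ⟨hT.fixedPoint, (hiff _).2 hT.fixedPoint_isFixedPt, fun Q hQ => ?_⟩
  exact hT.fixedPoint_unique ((hiff Q).1 hQ)

end Bellman

/-! ### The temporal-difference noise at a fixed value function -/

section TDNoise

variable {S A Ω : Type*} [Fintype S] [MeasurableSpace S] [MeasurableSingletonClass S]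
  [MeasurableSpace A] {m : MeasurableSpace Ω} {μ : Measure Ω}
  [IsProbabilityMeasure μ] {𝓕 : Filtration ℕ m} {M : ConvexQ.FiniteMDP S A}
  {st : ℕ → Ω → S} {ac : ℕ → Ω → A} {rw : ℕ → Ω → ℝ} {nx : ℕ → Ω → S}

theorem ConvexQ.GeneratedBy.condExp_comp_next (hgen : ConvexQ.GeneratedBy M μ 𝓕 st ac rw nx)
    (v : S → ℝ) (t : ℕ) :
    μ[fun ω => v (nx t ω) | 𝓕 t] =ᵐ[μ] fun ω => ∑ x, M.trans (st t ω) (ac t ω) x * v x := by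
  classical
  have hnx : Measurable (nx t) := (hgen.next_meas t).mono (𝓕.le _) le_rfl
  have heq : (fun ω => v (nx t ω)) =
      ∑ x, v x • (nx t ⁻¹' {x}).indicator (fun _ => (1 : ℝ)) := by
    ext ω
    simp [Set.indicator_apply]
  rw [heq]
  refine (condExp_finsetSum (fun x _ => ((integrable_const _).indicator
    (hnx (measurableSet_singleton x))).smul _) _).trans ?_
  filter_upwards [ae_all_iff.2 fun x => condExp_smul (μ := μ) (v x)
    ((nx t ⁻¹' {x}).indicator (fun _ => (1 : ℝ))) (𝓕 t), ae_all_iff.2 fun x => hgen.next_law t x]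
    with ω h1 h2
  rw [Finset.sum_apply]
  refine Finset.sum_congr rfl fun x _ => ?_
  rw [h1 x, Pi.smul_apply, h2 x, smul_eq_mul, mul_comm]

variable [Fintype A] [MeasurableSingletonClass A]

/-- For a fixed value function `v`, with `q` its one-step lookahead table, the weighted series of
the temporal-difference errors `r_t + γ v(s'_t) - q(s_t, a_t)` converges almost surely: these errors
have conditional mean zero and bounded conditional variance. -/
theorem ConvexQ.GeneratedBy.ae_exists_tendsto_sum_mul_noise
    (hgen : ConvexQ.GeneratedBy M μ 𝓕 st ac rw nx) (hvar : M.FiniteRewardVariance)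
    (γ : ℝ) (v : S → ℝ) {q : S → A → ℝ}
    (hq : ∀ s a, q s a = (∫ x, x ∂(M.rewardLaw s a)) + γ * ∑ s', M.trans s a s' * v s')
    {b : ℕ → Ω → ℝ} (hb : ∀ t, Measurable[𝓕 t] (b t))
    (hsq : ∀ᵐ ω ∂μ, Summable fun t => b t ω ^ 2) :
    ∀ᵐ ω ∂μ, ∃ l, Tendsto (fun N => ∑ t ∈ Finset.range N,
      b t ω * (rw t ω + γ * v (nx t ω) - q (st t ω) (ac t ω))) atTop (𝓝 l) := by
  have hprob : ∀ i : S × A, IsProbabilityMeasure (M.rewardLaw i.1 i.2) := fun i =>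
    M.rewardLaw_prob i.1 i.2
  have hZ : ∀ t, Measurable[𝓕 t] fun ω => (st t ω, ac t ω) := fun t =>
    (hgen.state_meas t).prodMk (hgen.action_meas t)
  have hrw : ∀ t, Measurable (rw t) := fun t => (hgen.reward_meas t).mono (𝓕.le _) le_rfl
  have hqm : ∀ t, Measurable[𝓕 t] fun ω => q (st t ω) (ac t ω) := fun t =>
    (measurable_of_finite fun i : S × A => q i.1 i.2).comp (hZ t)
  have hvm : ∀ t, Measurable[𝓕 (t + 1)] fun ω => v (nx t ω) := fun t =>
    (measurable_of_finite v).comp (hgen.next_meas t)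
  -- Everything but the reward is bounded by a constant `k`.
  obtain ⟨k, hk⟩ := (Set.finite_range
    fun p : S × S × A => |γ * v p.1 - q p.2.1 p.2.2|).bddAbove
  have hk' : ∀ t ω, |γ * v (nx t ω) - q (st t ω) (ac t ω)| ≤ k := fun t ω =>
    hk ⟨(nx t ω, st t ω, ac t ω), rfl⟩
  set f : ℝ → ℝ := fun x => 2 * x ^ 2 + 2 * k ^ 2 with hf
  have hfm : Measurable f := by fun_prop
  have hfi : ∀ i : S × A, Integrable f (M.rewardLaw i.1 i.2) := fun i =>
    ((hvar i.1 i.2).integrable_sq.const_mul 2).add (integrable_const _)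
  have hlaw : ∀ t, ∀ B, MeasurableSet B → μ⟦rw t ⁻¹' B | 𝓕 t⟧ =ᵐ[μ]
      fun ω => (M.rewardLaw (st t ω, ac t ω).1 (st t ω, ac t ω).2).real B := hgen.reward_law
  obtain ⟨C, hC⟩ := (Set.finite_range
    fun i : S × A => ∫ x, f x ∂(M.rewardLaw i.1 i.2)).bddAbove
  have hint : ∀ t, Integrable (rw t) μ := fun t =>
    integrable_comp_of_condLaw (ν := fun i : S × A => M.rewardLaw i.1 i.2) (𝓕.le t) (hrw t) (hZ t)
      (hlaw t) measurable_id fun i => (hvar i.1 i.2).integrable (by norm_num)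
  have hintf : ∀ t, Integrable (fun ω => f (rw t ω)) μ := fun t =>
    integrable_comp_of_condLaw (ν := fun i : S × A => M.rewardLaw i.1 i.2) (𝓕.le t) (hrw t) (hZ t)
      (hlaw t) hfm hfi
  have hnm : ∀ t, Measurable[𝓕 (t + 1)]
      fun ω => rw t ω + γ * v (nx t ω) - q (st t ω) (ac t ω) := fun t =>
    ((hgen.reward_meas t).add ((hvm t).const_mul γ)).sub
      ((hqm t).mono (𝓕.mono t.le_succ) le_rfl)
  have hle : ∀ t ω, (rw t ω + γ * v (nx t ω) - q (st t ω) (ac t ω)) ^ 2 ≤ f (rw t ω) :=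
    fun t ω => by
      have h1 := sq_le_sq' (abs_le.1 (hk' t ω)).1 (abs_le.1 (hk' t ω)).2
      simp only [hf]
      nlinarith [sq_nonneg (rw t ω - (γ * v (nx t ω) - q (st t ω) (ac t ω)))]
  have hsqi : ∀ t, Integrable
      (fun ω => (rw t ω + γ * v (nx t ω) - q (st t ω) (ac t ω)) ^ 2) μ := fun t =>
    (hintf t).mono' (((hnm t).mono (𝓕.le _) le_rfl).pow_const 2).aestronglyMeasurable
      (ae_of_all _ fun ω => by
        rw [Real.norm_eq_abs, abs_of_nonneg (sq_nonneg _)]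
        exact hle t ω)
  have hn2 : ∀ t, MemLp (fun ω => rw t ω + γ * v (nx t ω) - q (st t ω) (ac t ω)) 2 μ := fun t =>
    (memLp_two_iff_integrable_sq ((hnm t).mono (𝓕.le _) le_rfl).aestronglyMeasurable).2 (hsqi t)
  refine ae_exists_tendsto_sum_mul hb hnm hn2 (fun t => ?_) (C := max C 0) (le_max_right _ _)
    (fun t => ?_) hsq
  · have hvi : Integrable (fun ω => γ * v (nx t ω)) μ := by
      obtain ⟨c, hc⟩ := (Set.finite_range fun x => ‖γ * v x‖).bddAbove
      exact Integrable.of_bound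
        (((hvm t).const_mul γ).mono (𝓕.le _) le_rfl).aestronglyMeasurable c
        (ae_of_all _ fun ω => hc ⟨nx t ω, rfl⟩)
    have hqi : Integrable (fun ω => q (st t ω) (ac t ω)) μ := by
      obtain ⟨c, hc⟩ := (Set.finite_range fun i : S × A => ‖q i.1 i.2‖).bddAbove
      exact Integrable.of_bound ((hqm t).mono (𝓕.le _) le_rfl).aestronglyMeasurable c
        (ae_of_all _ fun ω => hc ⟨(st t ω, ac t ω), rfl⟩)
    have h1 := condExp_sub ((hint t).add hvi) hqi (𝓕 t)
    have h2 := condExp_add (hint t) hvi (𝓕 t)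
    have h3 := condExp_smul (μ := μ) γ (fun ω => v (nx t ω)) (𝓕 t)
    have h4 := condExp_comp_of_condLaw (ν := fun i : S × A => M.rewardLaw i.1 i.2) (𝓕.le t)
      (hrw t) (hZ t) (hlaw t) measurable_id fun i => (hvar i.1 i.2).integrable (by norm_num)
    have h5 := hgen.condExp_comp_next v t
    have h6 := condExp_of_stronglyMeasurable (𝓕.le t) (hqm t).stronglyMeasurable hqi
    filter_upwards [h1, h2, h3, h4, h5] with ω h1 h2 h3 h4 h5
    refine h1.trans ?_
    rw [Pi.sub_apply, h2, Pi.add_apply, h6]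
    change _ + (μ[γ • fun ω => v (nx t ω) | 𝓕 t]) ω - _ = 0
    rw [h3, Pi.smul_apply, h5, smul_eq_mul]
    simp only [hq]
    change (μ[fun ω => id (rw t ω) | 𝓕 t]) ω + _ -
      ((∫ x, x ∂M.rewardLaw (st t ω) (ac t ω)) + _) = 0
    rw [h4]
    simp
  · filter_upwards [condExp_mono (m := 𝓕 t) (hsqi t) (hintf t) (ae_of_all _ (hle t)),
      condExp_comp_of_condLaw (ν := fun i : S × A => M.rewardLaw i.1 i.2) (𝓕.le t)
        (hrw t) (hZ t) (hlaw t) hfm hfi] with ω h1 h2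
    exact h1.trans (h2.trans_le ((hC ⟨(st t ω, ac t ω), rfl⟩).trans (le_max_left _ _)))

end TDNoise

/-! ### Pathwise convergence of the tables -/

section Pathwise

variable {S A : Type*}

/-- The target of convex Q-learning is within `|Q^A - Q^B|` of the target that uses `Q^A` alone. -/
theorem ConvexQ.abs_target_sub_le {γ lam : ℝ} (hγ0 : 0 ≤ γ) (hlam0 : 0 ≤ lam) (hlam1 : lam ≤ 1)
    (qA qB : S → A → ℝ) (r : ℝ) (s : S) (b : A) :
    |ConvexQ.target γ lam qA qB r s b - (r + γ * qA s b)| ≤ γ * |qA s b - qB s b| := by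
  have h : ConvexQ.target γ lam qA qB r s b - (r + γ * qA s b) = γ *
      (lam * min (qA s b) (qB s b) + (1 - lam) * max (qA s b) (qB s b) - qA s b) := by
    unfold ConvexQ.target
    ring
  rw [h, abs_mul, abs_of_nonneg hγ0]
  refine mul_le_mul_of_nonneg_left ?_ hγ0
  rcases le_total (qA s b) (qB s b) with h | h
  · rw [min_eq_left h, max_eq_right h, abs_sub_comm (qA s b), abs_of_nonneg (sub_nonneg.2 h), abs_le]
    constructor <;> nlinarith
  · rw [min_eq_right h, max_eq_left h, abs_of_nonneg (sub_nonneg.2 h), abs_le]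
    constructor <;> nlinarith

variable [Fintype S] [Fintype A]

/-- Along a single trajectory, convex Q-learning converges to any table `q` for which the weighted
series of temporal-difference errors at `q` converges. Only the noise at the fixed table `q` enters,
because the sampled update is a `γ`-contraction around `q` for every realisation of the next
state. -/
theorem ConvexQ.tendsto_tables_of_noise_series {γ lam : ℝ} (hγ0 : 0 ≤ γ) (hγ1 : γ < 1)
    (hlam0 : 0 ≤ lam) (hlam1 : lam ≤ 1) {st nx : ℕ → S} {ac gr : ℕ → A} {r : ℕ → ℝ}
    {a qA qB : ℕ → S → A → ℝ} {q : S → A → ℝ}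
    (ha : ∀ t s b, a t s b ∈ Set.Icc (0 : ℝ) 1)
    (hoff : ∀ t s b, (s, b) ≠ (st t, ac t) → a t s b = 0)
    (hsum : ∀ s b, Tendsto (fun n => ∑ t ∈ Finset.range n, a t s b) atTop atTop)
    (hgr : ∀ t b, qA t (nx t) b ≤ qA t (nx t) (gr t))
    (hA : ∀ t s b, qA (t + 1) s b = qA t s b +
      a t s b * (ConvexQ.target γ lam (qA t) (qB t) (r t) (nx t) (gr t) - qA t s b))
    (hB : ∀ t s b, qB (t + 1) s b = qB t s b +
      a t s b * (ConvexQ.target γ lam (qA t) (qB t) (r t) (nx t) (gr t) - qB t s b))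
    (hnoise : ∀ s b, ∃ l, Tendsto (fun N => ∑ t ∈ Finset.range N,
      a t s b * (r t + γ * (⨆ b', q (nx t) b') - q (st t) (ac t))) atTop (𝓝 l)) (s : S) (b : A) :
    Tendsto (fun t => qA t s b) atTop (𝓝 (q s b)) ∧
      Tendsto (fun t => qB t s b) atTop (𝓝 (q s b)) := by
  have : Nonempty A := ⟨b⟩
  set n : ℕ → ℝ := fun t => r t + γ * (⨆ b', q (nx t) b') - q (st t) (ac t) with hn
  set y : ℕ → ℝ := fun t => ConvexQ.target γ lam (qA t) (qB t) (r t) (nx t) (gr t) with hy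
  -- The tables share their target, so their difference only shrinks.
  let d : ℕ → S × A → ℝ := fun t i => qA t i.1 i.2 - qB t i.1 i.2
  have hd : Tendsto d atTop (𝓝 0) := tendsto_pi_nhds.2 fun i =>
    tendsto_zero_of_averaging (c := fun _ => 0) (fun t => ha t i.1 i.2) (hsum i.1 i.2)
      (fun t => by simp only [d, hA, hB]; ring) tendsto_const_nhds
  -- `w` is the averaged noise, and `x` the error of `qA` after removing it.
  let w : ℕ → S × A → ℝ := fun t i =>
    Nat.rec (motive := fun _ => ℝ) 0 (fun t u => (1 - a t i.1 i.2) * u + a t i.1 i.2 * n t) t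
  have hw : Tendsto w atTop (𝓝 0) := tendsto_pi_nhds.2 fun i => by
    obtain ⟨l, hl⟩ := hnoise i.1 i.2
    exact tendsto_zero_of_averaging_of_series (fun t => ha t i.1 i.2) (hsum i.1 i.2)
      (fun t => rfl) hl
  let x : ℕ → S × A → ℝ := fun t i => qA t i.1 i.2 - q i.1 i.2 - w t i
  have hx : Tendsto x atTop (𝓝 0) := by
    refine tendsto_zero_of_contracting_averaging (a := fun t i => a t i.1 i.2)
      (c := fun t _ => y t - q (st t) (ac t) - n t) (ε := fun t => ‖w t‖ + ‖d t‖) hγ0 hγ1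
      (fun t i => ha t i.1 i.2) (fun i => hsum i.1 i.2) (fun t i => ?_) (fun t _ => ?_)
      (by simpa using hw.norm.add hd.norm)
    · have hwt : w (t + 1) i = (1 - a t i.1 i.2) * w t i + a t i.1 i.2 * n t := rfl
      have hq : a t i.1 i.2 * q i.1 i.2 = a t i.1 i.2 * q (st t) (ac t) := by
        by_cases h : (i.1, i.2) = (st t, ac t)
        · rw [(Prod.ext_iff.1 h).1, (Prod.ext_iff.1 h).2]
        · rw [hoff t _ _ h, zero_mul, zero_mul]
      simp only [x, hA, hwt]
      linear_combination -hq
    · have hmax : (⨆ b', qA t (nx t) b') = qA t (nx t) (gr t) :=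
        le_antisymm (ciSup_le (hgr t))
          (le_ciSup (Set.finite_range (qA t (nx t))).bddAbove (gr t))
      have h1 : |y t - (r t + γ * qA t (nx t) (gr t))| ≤ γ * ‖d t‖ :=
        (ConvexQ.abs_target_sub_le hγ0 hlam0 hlam1 _ _ _ _ _).trans
          (mul_le_mul_of_nonneg_left (norm_le_pi_norm (d t) (nx t, gr t)) hγ0)
      have h2 : |(⨆ b', qA t (nx t) b') - ⨆ b', q (nx t) b'| ≤ ‖x t‖ + ‖w t‖ :=
        abs_ciSup_sub_ciSup_le fun b' => by
          have h3 : qA t (nx t) b' - q (nx t) b' = x t (nx t, b') + w t (nx t, b') := by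
            simp only [x]
            ring
          rw [h3]
          exact (abs_add_le _ _).trans (add_le_add (norm_le_pi_norm (x t) (nx t, b'))
            (norm_le_pi_norm (w t) (nx t, b')))
      have h3 : y t - q (st t) (ac t) - n t = (y t - (r t + γ * qA t (nx t) (gr t))) +
          γ * ((⨆ b', qA t (nx t) b') - ⨆ b', q (nx t) b') := by
        rw [hmax]
        simp only [hn]
        ring
      rw [h3]
      refine (abs_add_le _ _).trans ?_
      rw [abs_mul, abs_of_nonneg hγ0]
      linarith [mul_le_mul_of_nonneg_left h2 hγ0]
  have hAlim : Tendsto (fun t => qA t s b) atTop (𝓝 (q s b)) := by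
    have h := ((tendsto_pi_nhds.1 hx (s, b)).add (tendsto_pi_nhds.1 hw (s, b))).add_const (q s b)
    simpa [x] using h
  refine ⟨hAlim, ?_⟩
  simpa [d] using hAlim.sub (tendsto_pi_nhds.1 hd (s, b))

end Pathwise

/-! ### Almost sure convergence of convex Q-learning -/

theorem theorem5 {S A Ω : Type*} [Fintype S] [Fintype A]
    [MeasurableSpace S] [MeasurableSingletonClass S]
    [MeasurableSpace A] [MeasurableSingletonClass A]
    {m : MeasurableSpace Ω} (μ : Measure Ω) [IsProbabilityMeasure μ] (𝓕 : Filtration ℕ m)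
    (M : ConvexQ.FiniteMDP S A) (hvar : M.FiniteRewardVariance)
    (γ : ℝ) (hγ0 : 0 ≤ γ) (hγ1 : γ < 1)
    (lam : ℝ) (hlam0 : 0 < lam) (hlam1 : lam ≤ 1)
    (st : ℕ → Ω → S) (ac : ℕ → Ω → A) (rw : ℕ → Ω → ℝ) (nx : ℕ → Ω → S)
    (hgen : ConvexQ.GeneratedBy M μ 𝓕 st ac rw nx)
    (hvisit : ∀ᵐ ω ∂μ, ∀ s a, ∃ᶠ t in atTop, st t ω = s ∧ ac t ω = a)
    (α : ℕ → Ω → S → A → ℝ) (hα : ConvexQ.RobbinsMonro μ 𝓕 st ac α)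
    (gr : ℕ → Ω → A) (QA QB : ℕ → Ω → S → A → ℝ)
    (hQ : ConvexQ.IsConvexQLearning 𝓕 γ lam rw nx α gr QA QB) :
    (∃! Q : S → A → ℝ, M.IsBellmanOptimal γ Q) ∧
    ∀ Qstar : S → A → ℝ, M.IsBellmanOptimal γ Qstar →
      ∀ᵐ ω ∂μ, ∀ s a,
        Tendsto (fun t => QA t ω s a) atTop (𝓝 (Qstar s a)) ∧
        Tendsto (fun t => QB t ω s a) atTop (𝓝 (Qstar s a)) := by
  obtain ⟨ω₀⟩ : Nonempty Ω := nonempty_of_isProbabilityMeasure μ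
  have : Nonempty A := ⟨ac 0 ω₀⟩
  refine ⟨M.existsUnique_isBellmanOptimal hγ0 hγ1, fun Qstar hstar => ?_⟩
  have hnoise : ∀ᵐ ω ∂μ, ∀ i : S × A, ∃ l, Tendsto (fun N => ∑ t ∈ Finset.range N,
      α t ω i.1 i.2 * (rw t ω + γ * (⨆ b', Qstar (nx t ω) b') - Qstar (st t ω) (ac t ω)))
      atTop (𝓝 l) :=
    ae_all_iff.2 fun i => hgen.ae_exists_tendsto_sum_mul_noise hvar γ (fun s => ⨆ b, Qstar s b)
      hstar (fun t => hα.meas t i.1 i.2) (hα.sum_sq.mono fun ω h => h i.1 i.2)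
  filter_upwards [hnoise, hα.mem_Icc, hα.zero_off, hα.sum_eq_top] with ω h1 h2 h3 h4 s a
  exact ConvexQ.tendsto_tables_of_noise_series hγ0 hγ1 hlam0.le hlam1 h2 h3 h4
    (fun t => hQ.greedy t ω) (fun t => hQ.updateA t ω) (fun t => hQ.updateB t ω)
    (fun s b => h1 (s, b)) s a
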